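/- Let $G$ be a group and let $A=\bigoplus_{g\in G}A_g$ be a unital $G$-graded ring that is epsilon-strongly graded: for every $g\in G$ the ideal $A_gA_{g^{-1}}$ of $R:=A_1$ has an identity element $\epsilon_g$, and $\epsilon_g a=a=a\epsilon_{g^{-1}}$ for all $a\in A_g$. Assume that $A_g\neq 0$ for only finitely many $g\in G$ (for instance, that $G$ is finite), and that $R$ is commutative. For each $g\in G$ choose $u_{i,g}\in A_g$ and $v_{i,g^{-1}}\in A_{g^{-1}}$ $(1\le i\le n_g)$ with $\sum_{i}u_{i,g}v_{i,g^{-1}}=\epsilon_g$, and let $\gamma=(R\epsilon_g,\gamma_g)_{g\in G}$ be the unital partial action of $G$ on $R$ given by the ring isomorphisms $$\gamma_g:R\epsilon_{g^{-1}}\to R\epsilon_g,\qquad \gamma_g(r)=\sum_{i=1}^{n_g}u_{i,g}\,r\,v_{i,g^{-1}} .$$ Let $R^\gamma=\{r\in R:\gamma_g(r\epsilon_{g^{-1}})=r\epsilon_g\text{ for all }g\in G\}$ be the subring of invariants. Suppose that $R^\gamma\subset R$ is a partial Galois extension, i.e. there are $m\ge 1$ and $x_1,\dots,x_m,y_1,\dots,y_m\in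 R$ with $$\sum_{i=1}^m x_i\,\gamma_g(y_i\epsilon_{g^{-1}})=\delta_{1,g}\qquad\text{for all }g\in G .$$ Then $A$ is an Azumaya $R^\gamma$-algebra, i.e. the center of $A$ is $R^\gamma$ and $A$ is separable over $R^\gamma$ (projective as an $A\otimes_{R^\gamma}A^{\mathrm{op}}$-module), and $R$ is a maximal commutative subalgebra of $A$. -/

import Mathlib

/-! ### Unital partial actions, invariants, partial Galois extensions -/

/-- A unital partial action of the group `G` on the ring `T`: for every `g` a central idempotent
`e g` generating the ideal `D g = T (e g) = {t | t * e g = t}`, and a ring isomorphism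
`act g : D g⁻¹ → D g`. (The values of `act g` outside `D g⁻¹` are irrelevant. For ideals generated
by central idempotents, intersections are products.) -/
structure UnitalPartialAction (G T : Type*) [Group G] [Ring T] where
  /-- the central idempotent `1_g` -/
  e : G → T
  e_idem : ∀ g, e g * e g = e g
  e_central : ∀ g t, e g * t = t * e g
  /-- the isomorphism from `D g⁻¹` to `D g` -/
  act : G → T → T
  bijOn : ∀ g, Set.BijOn (act g) {t | t * e g⁻¹ = t} {t | t * e g = t}
  map_add : ∀ g s t, s * e g⁻¹ = s → t * e g⁻¹ = t → act g (s + t) = act g s + act g t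
  map_mul : ∀ g s t, s * e g⁻¹ = s → t * e g⁻¹ = t → act g (s * t) = act g s * act g t
  e_one : e 1 = 1
  act_one : ∀ t, act 1 t = t
  image_inter : ∀ g h, act g '' ({t | t * e g⁻¹ = t} ∩ {t | t * e h = t}) =
    {t | t * e g = t} ∩ {t | t * e (g * h) = t}
  act_act : ∀ g h t, t * e h⁻¹ = t → t * e (g * h)⁻¹ = t → act g (act h t) = act (g * h) t

namespace UnitalPartialAction

variable {G T : Type*} [Group G] [Ring T] (ρ : UnitalPartialAction G T)

lemma mul_e_mem (g : G) (t : T) : t * ρ.e g * ρ.e g = t * ρ.e g := by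
  rw [mul_assoc, ρ.e_idem]

lemma act_e (g : G) : ρ.act g (ρ.e g⁻¹) = ρ.e g := by
  obtain ⟨t, ht, hte⟩ := (ρ.bijOn g).surjOn (show ρ.e g ∈ {t | t * ρ.e g = t} from ρ.e_idem g)
  have h1 := ρ.map_mul g t (ρ.e g⁻¹) ht (ρ.e_idem _)
  have h2 : ρ.act g (ρ.e g⁻¹) * ρ.e g = ρ.act g (ρ.e g⁻¹) :=
    (ρ.bijOn g).mapsTo (ρ.e_idem g⁻¹)
  rw [show t * ρ.e g⁻¹ = t from ht, hte, ρ.e_central, h2] at h1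
  exact h1.symm

lemma act_zero (g : G) : ρ.act g 0 = 0 := by
  have := ρ.map_add g 0 0 (by simp) (by simp)
  simpa using this

/-- The subring of invariants `T^ρ = {t | ρ_g (t 1_{g⁻¹}) = t 1_g for all g}`. -/
def invariants : Subring T where
  carrier := {t | ∀ g, ρ.act g (t * ρ.e g⁻¹) = t * ρ.e g}
  zero_mem' g := by simp [act_zero]
  one_mem' g := by simp [act_e]
  add_mem' {s t} hs ht g := by
    rw [add_mul, ρ.map_add _ _ _ (ρ.mul_e_mem _ _) (ρ.mul_e_mem _ _), hs g, ht g, add_mul]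
  neg_mem' {t} ht g := by
    have := ρ.map_add g (-t * ρ.e g⁻¹) (t * ρ.e g⁻¹) (ρ.mul_e_mem _ _) (ρ.mul_e_mem _ _)
    rw [← add_mul, neg_add_cancel, zero_mul, act_zero, ht g] at this
    rw [neg_mul t (ρ.e g)]
    exact eq_neg_of_add_eq_zero_left this.symm
  mul_mem' {s t} hs ht g := by
    have h (i : G) : s * t * ρ.e i = (s * ρ.e i) * (t * ρ.e i) := by
      rw [mul_assoc s (ρ.e i), ← mul_assoc (ρ.e i) t, ρ.e_central i t, mul_assoc t, ρ.e_idem,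
        mul_assoc]
    rw [h g⁻¹, ρ.map_mul _ _ _ (ρ.mul_e_mem _ _) (ρ.mul_e_mem _ _), hs g, ht g, ← h g]

open Classical in
/-- `T^ρ ⊆ T` is a partial Galois extension: it has a finite partial Galois coordinate system
`x, y` with `∑ i, x i * ρ_g (y i * 1_{g⁻¹}) = δ_{1,g}`. -/
def IsPartialGalois : Prop :=
  ∃ m : ℕ, 0 < m ∧ ∃ x y : Fin m → T,
    ∀ g : G, ∑ i, x i * ρ.act g (y i * ρ.e g⁻¹) = if g = 1 then 1 else 0

end UnitalPartialAction

/-! ### Azumaya algebras -/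

/-- `T` is a separable `S`-algebra: it is projective as a module over `T ⊗ Tᵐᵒᵖ`, which acts by
`(a ⊗ b) x = a x b`. -/
def IsSeparableAlgebra (S T : Type*) [CommRing S] [Ring T] [Algebra S T] : Prop :=
  letI := instModuleTensorProductMop S T
  Module.Projective (TensorProduct S T Tᵐᵒᵖ) T

/-- `T` is an Azumaya `S`-algebra: `S` is (via the structure map) the center of `T`, and `T` is
separable over `S`. -/
structure IsAzumayaAlgebra (S T : Type*) [CommRing S] [Ring T] [Algebra S T] : Prop where
  injective : Function.Injective (algebraMap S T)
  range_eq_center : (algebraMap S T).range = Subring.center T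
  separable : IsSeparableAlgebra S T

/-! ### Epsilon-strongly graded rings -/

section Graded

open scoped Pointwise

variable {G A : Type*} [Group G] [Ring A] (𝒜 : G → AddSubgroup A)

/-- The additive group `I` (closed under multiplication) has the identity element `e`. -/
def IsIdentityOf (e : A) (I : AddSubgroup A) : Prop :=
  e ∈ I ∧ ∀ x ∈ I, e * x = x ∧ x * e = x

/-- A grading `𝒜` of `A` by `G` is epsilon-strong if for every `g` the ideals `𝒜 g * 𝒜 g⁻¹` and
`𝒜 g⁻¹ * 𝒜 g` of `𝒜 1` are unital, and `𝒜 g` is a unital bimodule over them. The product of two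
additive subgroups is the additive subgroup generated by the products of elements. -/
def IsEpsilonStronglyGraded : Prop :=
  ∀ g, ∃ e f : A, IsIdentityOf e (𝒜 g * 𝒜 g⁻¹) ∧ IsIdentityOf f (𝒜 g⁻¹ * 𝒜 g) ∧
    ∀ a ∈ 𝒜 g, e * a = a ∧ a * f = a

variable {𝒜}

namespace IsEpsilonStronglyGraded

variable (h : IsEpsilonStronglyGraded 𝒜)

/-- The identity element `ε_g` of `𝒜 g * 𝒜 g⁻¹`. -/
noncomputable def eps (g : G) : A := (h g).choose

lemma eps_isIdentity (g : G) : IsIdentityOf (h.eps g) (𝒜 g * 𝒜 g⁻¹) :=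
  (h g).choose_spec.choose_spec.1

lemma eps_mul {g : G} {a : A} (ha : a ∈ 𝒜 g) : h.eps g * a = a :=
  ((h g).choose_spec.choose_spec.2.2 a ha).1

lemma mul_eps {g : G} {a : A} (ha : a ∈ 𝒜 g) : a * h.eps g⁻¹ = a := by
  obtain ⟨-, hf, hb⟩ := (h g).choose_spec.choose_spec
  have h2 := h.eps_isIdentity g⁻¹
  rw [inv_inv] at h2
  rw [← (hf.2 _ h2.1).1, (h2.2 _ hf.1).2]
  exact (hb a ha).2

/-- A choice, for every `g`, of finitely many `u_i ∈ 𝒜 g`, `v_i ∈ 𝒜 g⁻¹` with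
`∑ i, u_i v_i = ε_g`. -/
structure Factorization where
  n : G → ℕ
  u : (g : G) → Fin (n g) → A
  v : (g : G) → Fin (n g) → A
  u_mem : ∀ g i, u g i ∈ 𝒜 g
  v_mem : ∀ g i, v g i ∈ 𝒜 g⁻¹
  sum_eq : ∀ g, ∑ i, u g i * v g i = h.eps g

lemma factorization_nonempty : Nonempty h.Factorization := by
  have key : ∀ x g, x ∈ 𝒜 g * 𝒜 g⁻¹ → ∃ (n : ℕ) (u v : Fin n → A),
      (∀ i, u i ∈ 𝒜 g) ∧ (∀ i, v i ∈ 𝒜 g⁻¹) ∧ ∑ i, u i * v i = x := by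
    intro x g hx
    refine AddSubmonoid.mul_induction_on (M := (𝒜 g).toAddSubmonoid)
      (N := (𝒜 g⁻¹).toAddSubmonoid) hx ?_ ?_
    · intro a ha b hb
      exact ⟨1, fun _ => a, fun _ => b, fun _ => ha, fun _ => hb, by simp⟩
    · rintro _ _ ⟨n, u, v, hu, hv, rfl⟩ ⟨n', u', v', hu', hv', rfl⟩
      refine ⟨n + n', Fin.append u u', Fin.append v v', ?_, ?_, ?_⟩
      · intro i; refine Fin.addCases (fun i => ?_) (fun i => ?_) i <;> simp [hu, hu']
      · intro i; refine Fin.addCases (fun i => ?_) (fun i => ?_) i <;> simp [hv, hv']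
      · simp [Fin.sum_univ_add]
  choose n u v hu hv hs using fun g => key (h.eps g) g (h.eps_isIdentity g).1
  exact ⟨⟨n, u, v, hu, hv, hs⟩⟩

lemma eps_idem (g : G) : h.eps g * h.eps g = h.eps g :=
  ((h.eps_isIdentity g).2 _ (h.eps_isIdentity g).1).1

end IsEpsilonStronglyGraded

section One

variable (𝒜) [SetLike.GradedMonoid fun i : Additive G => 𝒜 i.toMul]

lemma grade_mul_mem {g k : G} {a b : A} (ha : a ∈ 𝒜 g) (hb : b ∈ 𝒜 k) : a * b ∈ 𝒜 (g * k) :=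
  SetLike.GradedMul.mul_mem (A := fun i : Additive G => 𝒜 i.toMul)
    (i := Additive.ofMul g) (j := Additive.ofMul k) ha hb

/-- The subring `R = 𝒜 1` of `A`. -/
def gradeOne : Subring A where
  __ := 𝒜 1
  mul_mem' ha hb := by simpa using grade_mul_mem 𝒜 ha hb
  one_mem' := SetLike.GradedOne.one_mem (A := fun i : Additive G => 𝒜 i.toMul)

lemma mem_gradeOne {a : A} : a ∈ gradeOne 𝒜 ↔ a ∈ 𝒜 1 := Iff.rfl

variable {𝒜}

lemma mem_one_of_mem_mul {g : G} {x : A} (hx : x ∈ 𝒜 g * 𝒜 g⁻¹) : x ∈ gradeOne 𝒜 := by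
  refine AddSubmonoid.mul_induction_on (M := (𝒜 g).toAddSubmonoid)
    (N := (𝒜 g⁻¹).toAddSubmonoid) hx ?_ fun _ _ => add_mem
  intro a ha b hb
  have := grade_mul_mem 𝒜 (show a ∈ 𝒜 g from ha) (show b ∈ 𝒜 g⁻¹ from hb)
  rwa [mul_inv_cancel] at this

namespace IsEpsilonStronglyGraded

variable (h : IsEpsilonStronglyGraded 𝒜)

lemma eps_mem (g : G) : h.eps g ∈ gradeOne 𝒜 := mem_one_of_mem_mul (h.eps_isIdentity g).1

/-- `ε_{g⁻¹} a = a ε_{k⁻¹ g⁻¹}` for `a ∈ 𝒜 k`. -/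
lemma eps_mul_eq {g k : G} {a : A} (ha : a ∈ 𝒜 k) :
    h.eps g⁻¹ * a = a * h.eps (k⁻¹ * g⁻¹) := by
  obtain ⟨d⟩ := h.factorization_nonempty
  have h1 : h.eps g⁻¹ * a * h.eps (k⁻¹ * g⁻¹) = h.eps g⁻¹ * a := by
    rw [← d.sum_eq g⁻¹]
    simp only [Finset.sum_mul]
    refine Finset.sum_congr rfl fun i _ => ?_
    have hv : d.v g⁻¹ i ∈ 𝒜 g := by simpa using d.v_mem g⁻¹ i
    have hm := h.mul_eps (grade_mul_mem 𝒜 hv ha)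
    rw [mul_inv_rev] at hm
    rw [mul_assoc (d.u g⁻¹ i) (d.v g⁻¹ i) a, mul_assoc (d.u g⁻¹ i), hm]
  have h2 : h.eps g⁻¹ * (a * h.eps (k⁻¹ * g⁻¹)) = a * h.eps (k⁻¹ * g⁻¹) := by
    rw [← d.sum_eq (k⁻¹ * g⁻¹)]
    simp only [Finset.mul_sum]
    refine Finset.sum_congr rfl fun i _ => ?_
    have hu := grade_mul_mem 𝒜 ha (d.u_mem (k⁻¹ * g⁻¹) i)
    rw [mul_inv_cancel_left] at hu
    rw [← mul_assoc a, ← mul_assoc (h.eps g⁻¹), h.eps_mul hu]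
  rw [← h1, mul_assoc, h2]

namespace Factorization

variable {h} (d : h.Factorization)

/-- The map `Γ_g : A → A`, `a ↦ ∑ i, u_i a v_i`. -/
def Gam (g : G) (a : A) : A := ∑ i, d.u g i * a * d.v g i

lemma Gam_mem {g : G} {r : A} (hr : r ∈ gradeOne 𝒜) : d.Gam g r ∈ gradeOne 𝒜 := by
  refine sum_mem fun i _ => ?_
  have := grade_mul_mem 𝒜 (grade_mul_mem 𝒜 (d.u_mem g i) (show r ∈ 𝒜 1 from hr)) (d.v_mem g i)
  rwa [mul_one, mul_inv_cancel] at this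

lemma gradeOne_comm (hR : ∀ r s : gradeOne 𝒜, r * s = s * r)
    {r s : A} (hr : r ∈ gradeOne 𝒜) (hs : s ∈ gradeOne 𝒜) : r * s = s * r :=
  congrArg Subtype.val (hR ⟨r, hr⟩ ⟨s, hs⟩)

lemma Gam_mul (hR : ∀ r s : gradeOne 𝒜, r * s = s * r)
    {g : G} {r a : A} (hr : r ∈ gradeOne 𝒜) (ha : a ∈ 𝒜 g) :
    d.Gam g r * a = a * r := by
  have : ∀ i, d.u g i * r * d.v g i * a = d.u g i * d.v g i * a * r := fun i => by
    have hm : d.v g i * a ∈ gradeOne 𝒜 := by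
      have := grade_mul_mem 𝒜 (d.v_mem g i) ha
      rwa [inv_mul_cancel] at this
    rw [mul_assoc, mul_assoc, gradeOne_comm hR hr hm]
    simp only [mul_assoc]
  rw [Gam, Finset.sum_mul, Finset.sum_congr rfl fun i _ => this i, ← Finset.sum_mul,
    ← Finset.sum_mul, d.sum_eq, h.eps_mul ha]

lemma Gam_mul_eps {g : G} {r : A} : d.Gam g r * h.eps g = d.Gam g r := by
  rw [Gam, Finset.sum_mul]
  refine Finset.sum_congr rfl fun i _ => ?_
  have := h.mul_eps (d.v_mem g i)
  rw [inv_inv] at this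
  rw [mul_assoc, this]

/-- `Γ_g r` is the only element of `R ε_g` with `s a = a r` for all `a ∈ 𝒜 g`. -/
lemma eq_Gam (hR : ∀ r s : gradeOne 𝒜, r * s = s * r)
    {g : G} {r s : A} (hs' : s * h.eps g = s)
    (hr : r ∈ gradeOne 𝒜) (hsa : ∀ a ∈ 𝒜 g, s * a = a * r) : s = d.Gam g r := by
  rw [← hs', ← d.Gam_mul_eps (r := r), ← d.sum_eq, Finset.mul_sum, Finset.mul_sum]
  refine Finset.sum_congr rfl fun i _ => ?_
  rw [← mul_assoc, ← mul_assoc, hsa _ (d.u_mem g i), d.Gam_mul hR hr (d.u_mem g i)]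

lemma Gam_Gam_inv (hR : ∀ r s : gradeOne 𝒜, r * s = s * r)
    {g : G} {s : A} (hs : s ∈ gradeOne 𝒜) (hs' : s * h.eps g = s) :
    d.Gam g (d.Gam g⁻¹ s) = s := by
  refine (d.eq_Gam hR hs' (d.Gam_mem hs) fun a ha => ?_).symm
  have : ∀ i, a * (d.u g⁻¹ i * s * d.v g⁻¹ i) = s * (a * (d.u g⁻¹ i * d.v g⁻¹ i)) := fun i => by
    have hm : a * d.u g⁻¹ i ∈ gradeOne 𝒜 := by
      have := grade_mul_mem 𝒜 ha (d.u_mem g⁻¹ i)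
      rwa [mul_inv_cancel] at this
    rw [← mul_assoc, ← mul_assoc, gradeOne_comm hR hm hs]
    simp only [mul_assoc]
  rw [Gam, Finset.mul_sum, Finset.sum_congr rfl fun i _ => this i, ← Finset.mul_sum,
    ← Finset.mul_sum, d.sum_eq, h.mul_eps ha]

lemma Gam_mul_map (hR : ∀ r s : gradeOne 𝒜, r * s = s * r)
    {g : G} {r s : A} (hr : r ∈ gradeOne 𝒜) (hs : s ∈ gradeOne 𝒜) :
    d.Gam g (r * s) = d.Gam g r * d.Gam g s := by
  refine (d.eq_Gam hR ?_ (mul_mem hr hs) fun a ha => ?_).symm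
  · rw [mul_assoc, d.Gam_mul_eps]
  · have hm : a * s ∈ 𝒜 g := by simpa using grade_mul_mem 𝒜 ha (show s ∈ 𝒜 1 from hs)
    rw [mul_assoc, d.Gam_mul hR hs ha, d.Gam_mul hR hr hm, mul_assoc, gradeOne_comm hR hs hr]

lemma Gam_eps (hR : ∀ r s : gradeOne 𝒜, r * s = s * r)
    (g k : G) : d.Gam g (h.eps k) = h.eps g * h.eps (g * k) := by
  refine (d.eq_Gam hR ?_ (h.eps_mem k) fun a ha => ?_).symm
  · rw [mul_assoc, gradeOne_comm hR (h.eps_mem _) (h.eps_mem g), ← mul_assoc,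
      ((h.eps_isIdentity g).2 _ (h.eps_isIdentity g).1).1]
  · have := h.eps_mul_eq (g := (g * k)⁻¹) ha
    rw [inv_inv, inv_mul_cancel_left] at this
    have hm : a * h.eps k ∈ 𝒜 g := by
      simpa using grade_mul_mem 𝒜 ha (show h.eps k ∈ 𝒜 1 from h.eps_mem k)
    rw [mul_assoc, this, h.eps_mul hm]

lemma Gam_inter (hR : ∀ r s : gradeOne 𝒜, r * s = s * r)
    {g k : G} {t : A} (ht : t ∈ gradeOne 𝒜) (hk : t * h.eps k = t) :
    d.Gam g t * h.eps (g * k) = d.Gam g t := by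
  have : d.Gam g t = d.Gam g t * (h.eps g * h.eps (g * k)) := by
    rw [← d.Gam_eps hR, ← d.Gam_mul_map hR ht (h.eps_mem k), hk]
  rw [this, mul_assoc, mul_assoc, h.eps_idem]

lemma Gam_Gam (hR : ∀ r s : gradeOne 𝒜, r * s = s * r)
    {g k : G} {t : A} (ht : t ∈ gradeOne 𝒜) (hk : t * h.eps k⁻¹ = t) : d.Gam g (d.Gam k t) = d.Gam (g * k) t := by
  refine d.eq_Gam hR ?_ ht fun c hc => ?_
  · refine d.Gam_inter hR (d.Gam_mem ht) ?_
    exact d.Gam_mul_eps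
  · have h1 : c * h.eps k⁻¹ = h.eps g * c := by
      have := h.eps_mul_eq (g := g⁻¹) hc
      rw [inv_inv] at this
      rw [this]; congr 2; group
    have h2 : c * t = h.eps g * c * t := by
      rw [← h1, mul_assoc, gradeOne_comm hR (h.eps_mem _) ht, hk]
    have h3 : ∀ i, d.Gam g (d.Gam k t) * (d.u g i * d.v g i * c) = d.u g i * d.v g i * c * t := by
      intro i
      have hm : d.v g i * c ∈ 𝒜 k := by
        have := grade_mul_mem 𝒜 (d.v_mem g i) hc
        rwa [inv_mul_cancel_left] at this
      rw [mul_assoc (d.u g i), ← mul_assoc, d.Gam_mul hR (d.Gam_mem ht) (d.u_mem g i), mul_assoc,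
        d.Gam_mul hR ht hm]
      simp only [mul_assoc]
    rw [h2, ← d.Gam_mul_eps (g := g), ← d.sum_eq, mul_assoc, Finset.sum_mul, Finset.sum_mul,
      Finset.mul_sum]
    exact Finset.sum_congr rfl fun i _ => h3 i

lemma eps_one (h : IsEpsilonStronglyGraded 𝒜) : h.eps (1 : G) = 1 := by
  have := h.eps_mul (show (1 : A) ∈ 𝒜 1 from (gradeOne 𝒜).one_mem)
  simpa using this

variable (hR : ∀ r s : gradeOne 𝒜, r * s = s * r)

/-- The unital partial action `γ = (R ε_g, γ_g)` of `G` on the commutative ring `R = 𝒜 1`, where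
`γ_g : R ε_{g⁻¹} → R ε_g` is the restriction of `Γ_g`. -/
noncomputable def gamma : UnitalPartialAction G (gradeOne 𝒜) where
  e g := ⟨h.eps g, h.eps_mem g⟩
  e_idem g := Subtype.ext (h.eps_idem g)
  e_central g t := hR _ _
  act g r := ⟨d.Gam g r, d.Gam_mem r.2⟩
  bijOn g := by
    have aux (g : G) (t : gradeOne 𝒜) : t * ⟨h.eps g, h.eps_mem g⟩ = t ↔
        (t : A) * h.eps g = t := Subtype.ext_iff
    simp only [aux]
    refine Set.BijOn.mk ?_ ?_ ?_
    · intro t _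
      exact d.Gam_mul_eps
    · intro s hs t ht hst
      have hst' : d.Gam g s = d.Gam g t := congrArg Subtype.val hst
      have h1 := d.Gam_Gam_inv hR (g := g⁻¹) s.2 hs
      have h2 := d.Gam_Gam_inv hR (g := g⁻¹) t.2 ht
      rw [inv_inv] at h1 h2
      exact Subtype.ext (by rw [← h1, ← h2, hst'])
    · intro s hs
      exact ⟨⟨d.Gam g⁻¹ s, d.Gam_mem s.2⟩, d.Gam_mul_eps,
        Subtype.ext (d.Gam_Gam_inv hR s.2 hs)⟩
  map_add g s t _ _ := Subtype.ext (by
    simp [Gam, mul_add, add_mul, Finset.sum_add_distrib])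
  map_mul g s t _ _ := Subtype.ext (d.Gam_mul_map hR s.2 t.2)
  e_one := Subtype.ext (eps_one h)
  act_one t := Subtype.ext (d.eq_Gam hR (by rw [eps_one h, mul_one]) t.2
    fun a ha => gradeOne_comm hR t.2 ha).symm
  image_inter g k := by
    have aux (g : G) (t : gradeOne 𝒜) : t * ⟨h.eps g, h.eps_mem g⟩ = t ↔
        (t : A) * h.eps g = t := Subtype.ext_iff
    simp only [aux]
    ext s
    constructor
    · rintro ⟨t, ⟨-, ht⟩, rfl⟩
      exact ⟨d.Gam_mul_eps, d.Gam_inter hR t.2 ht⟩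
    · rintro ⟨hs, hs'⟩
      refine ⟨⟨d.Gam g⁻¹ s, d.Gam_mem s.2⟩, ⟨d.Gam_mul_eps, ?_⟩,
        Subtype.ext (d.Gam_Gam_inv hR s.2 hs)⟩
      have := d.Gam_inter hR (g := g⁻¹) s.2 hs'
      rwa [inv_mul_cancel_left] at this
  act_act g k t h1 _ := Subtype.ext (d.Gam_Gam hR t.2 (congrArg Subtype.val h1))

/-- The invariants `R^γ` form a commutative ring. -/
noncomputable abbrev invariantsCommRing : CommRing (d.gamma hR).invariants where
  __ := (inferInstance : Ring (d.gamma hR).invariants)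
  mul_comm r s := Subtype.ext (hR r s)

end Factorization

end IsEpsilonStronglyGraded

end One

namespace IsEpsilonStronglyGraded.Factorization

variable [DecidableEq G] [GradedRing fun i : Additive G => 𝒜 i.toMul]
  {h : IsEpsilonStronglyGraded 𝒜} (d : h.Factorization)
  (hR : ∀ r s : gradeOne 𝒜, r * s = s * r)

/-- `R^γ` is contained in the center of `A`. -/
lemma invariants_comm
    (r : (d.gamma hR).invariants) (a : A) : (r : A) * a = a * r := by
  induction a using DirectSum.Decomposition.inductionOn (fun i : Additive G => 𝒜 i.toMul) with
  | zero => simp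
  | add a b ha hb => rw [mul_add, add_mul, ha, hb]
  | homogeneous a =>
    rename_i i
    obtain ⟨a, ha⟩ := a
    have ha : a ∈ 𝒜 i.toMul := ha
    have h1 : d.Gam i.toMul ((r : A) * h.eps i.toMul⁻¹) = r * h.eps i.toMul :=
      congrArg Subtype.val (r.2 i.toMul)
    have hr : (r : A) ∈ gradeOne 𝒜 := r.1.2
    have h2 := d.Gam_mul hR (mul_mem hr (h.eps_mem i.toMul⁻¹)) ha
    rw [h1, mul_assoc, h.eps_mul ha, gradeOne_comm hR hr (h.eps_mem _), ← mul_assoc, h.mul_eps ha] at h2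
    exact h2

/-- `A` as an algebra over `R^γ`, through the inclusions `R^γ ⊆ R ⊆ A`. -/
noncomputable abbrev invariantsAlgebra :
    letI := d.invariantsCommRing hR
    Algebra (d.gamma hR).invariants A :=
  letI := d.invariantsCommRing hR
  RingHom.toAlgebra' ((gradeOne 𝒜).subtype.comp (d.gamma hR).invariants.subtype)
    (d.invariants_comm hR)

/-- `R = 𝒜 1` as a subalgebra of the `R^γ`-algebra `A`. -/
noncomputable def gradeOneSubalgebra :
    letI := d.invariantsCommRing hR
    letI := d.invariantsAlgebra hR
    Subalgebra (d.gamma hR).invariants A :=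
  letI := d.invariantsCommRing hR
  letI := d.invariantsAlgebra hR
  { gradeOne 𝒜 with algebraMap_mem' := fun r => r.1.2 }

end IsEpsilonStronglyGraded.Factorization

end Graded

/-!
The argument rests on the identity `Γ_g(r) a = a r` for `a ∈ A_g`, `r ∈ R`. Through it a partial
Galois coordinate system `x, y` satisfies `∑ i, x i * a * y i = a₁` for every `a ∈ A`, where `a₁` is
the component of degree one; in particular the sum lies in `R` (`sum_mul_mul_mem`). If `a` commutes
with `R`, the sum is `a` itself, so `R` is its own centralizer and contains the center; an element
of `R` is central exactly when it is invariant.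

For separability, let `tr r = ∑ g, Γ_g(r)` be the trace, a finite sum with values in `R^γ`. The
coordinate system gives the dual basis formula `r = ∑ j, x j * tr (y j * r)`, so `R` is finitely
generated over `R^γ` and `R = tr(R) R`; the determinant trick then produces `c ∈ R` with
`tr c = 1` (`exists_trace_eq_one`). The dual basis formula also shows that `∑ i, x i ⊗ y i`
intertwines the left and right actions of `R` (`galoisTensor_comm`). Then
`∑ g, ∑ j, ∑ i, u_{j,g} c (x i) ⊗ (y i) v_{j,g⁻¹}` is a separability element of `A` over `R^γ`: for
`a ∈ A_h`, left multiplication by `a` on the summand of index `g` agrees with right multiplication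
by `a` on the summand of index `h g`, because `a u = ∑ k, u_k (v_k a u)` with `u_k` of degree `h g`
and `v_k a u ∈ R`.
-/

open scoped TensorProduct
open MulOpposite (op)

/-! ### Separability elements -/

/-- An algebra with a separability element is separable. The multiplication of `Tᵐᵒᵖ` turns right
multiplication of the second factor by `a` into left multiplication by `1 ⊗ op a`. -/
theorem IsSeparableAlgebra.of_separabilityElement {S T : Type*} [CommRing S] [Ring T] [Algebra S T]
    (z : T ⊗[S] Tᵐᵒᵖ) (hcomm : ∀ a : T, (a ⊗ₜ[S] (1 : Tᵐᵒᵖ)) * z = ((1 : T) ⊗ₜ[S] op a) * z)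
    (hone : letI := instModuleTensorProductMop S T; z • (1 : T) = 1) :
    IsSeparableAlgebra S T := by
  unfold IsSeparableAlgebra
  let := instModuleTensorProductMop S T
  have hsmul (a b c : T) : (a ⊗ₜ[S] op b) • c = a * (c * b) := rfl
  let p : (T ⊗[S] Tᵐᵒᵖ) →ₗ[T ⊗[S] Tᵐᵒᵖ] T := LinearMap.toSpanSingleton _ _ 1
  let i : T →ₗ[T ⊗[S] Tᵐᵒᵖ] (T ⊗[S] Tᵐᵒᵖ) :=
    { toFun a := (a ⊗ₜ[S] 1) * z
      map_add' a b := by rw [TensorProduct.add_tmul, add_mul]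
      map_smul' w a := by
        induction w using TensorProduct.induction_on with
        | zero =>
          have h0 : (0 : T ⊗[S] Tᵐᵒᵖ) • a = 0 := zero_smul (T ⊗[S] Tᵐᵒᵖ) a
          exact (congrArg (fun b => (b ⊗ₜ[S] (1 : Tᵐᵒᵖ)) * z) h0).trans (by simp)
        | add w w' hw hw' =>
          rw [add_smul, TensorProduct.add_tmul, add_mul, hw, hw', RingHom.id_apply,
            RingHom.id_apply, RingHom.id_apply, add_smul]
        | tmul b c =>
          obtain ⟨c, rfl⟩ := MulOpposite.op_surjective c
          rw [hsmul, RingHom.id_apply, smul_eq_mul]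
          have h1 : (b * (a * c)) ⊗ₜ[S] (1 : Tᵐᵒᵖ) = ((b * a) ⊗ₜ[S] 1) * (c ⊗ₜ[S] 1) := by
            simp [mul_assoc]
          have h2 : (b ⊗ₜ[S] op c) * (a ⊗ₜ[S] (1 : Tᵐᵒᵖ)) = ((b * a) ⊗ₜ[S] 1) * (1 ⊗ₜ[S] op c) := by
            simp
          rw [h1, mul_assoc, hcomm, ← mul_assoc, ← mul_assoc, h2] }
  refine Module.Projective.of_split i p (LinearMap.ext fun a => ?_)
  change ((a ⊗ₜ[S] (1 : Tᵐᵒᵖ)) * z) • (1 : T) = a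
  rw [mul_smul, hone]
  simpa using hsmul a 1 1

namespace IsEpsilonStronglyGraded.Factorization

open scoped Pointwise

variable {G A : Type*} [Group G] [Ring A] {𝒜 : G → AddSubgroup A}
  {h : IsEpsilonStronglyGraded 𝒜} (d : h.Factorization)

/-! ### The partial trace -/

lemma Gam_add (g : G) (a b : A) : d.Gam g (a + b) = d.Gam g a + d.Gam g b := by
  simp [Gam, mul_add, add_mul, Finset.sum_add_distrib]

lemma Gam_sum {ι : Type*} (s : Finset ι) (g : G) (f : ι → A) :
    d.Gam g (∑ i ∈ s, f i) = ∑ i ∈ s, d.Gam g (f i) :=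
  map_sum (AddMonoidHom.mk' (d.Gam g) (d.Gam_add g)) f s

lemma Gam_zero (g : G) : d.Gam g 0 = 0 := by simp [Gam]

lemma u_eq_zero {g : G} (hg : 𝒜 g = ⊥) (i : Fin (d.n g)) : d.u g i = 0 := by
  simpa [hg] using d.u_mem g i

lemma finite_support_of_u_eq_zero {M : Type*} [Zero M] (hfin : {g : G | 𝒜 g ≠ ⊥}.Finite)
    {f : G → M} (hf : ∀ g, (∀ i, d.u g i = 0) → f g = 0) : (Function.support f).Finite :=
  hfin.subset fun g hg h0 => hg (hf g (d.u_eq_zero h0))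

lemma finite_support_Gam (hfin : {g : G | 𝒜 g ≠ ⊥}.Finite) (r : A) :
    (Function.support fun g => d.Gam g r).Finite :=
  d.finite_support_of_u_eq_zero hfin fun g hg => by simp [Gam, hg]

/-- The partial trace `r ↦ ∑ g, Γ_g(r)`, which for `r ∈ R` is `∑ g, γ_g(r ε_{g⁻¹})`. It is only used
when finitely many components of the grading are nonzero, so that the sum is finite. -/
noncomputable def trace (r : A) : A := ∑ᶠ g, d.Gam g r

lemma mul_trace (hfin : {g : G | 𝒜 g ≠ ⊥}.Finite) (a r : A) :
    a * d.trace r = ∑ᶠ g, a * d.Gam g r :=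
  mul_finsum' _ _ (d.finite_support_Gam hfin r)

lemma trace_add (hfin : {g : G | 𝒜 g ≠ ⊥}.Finite) (r s : A) :
    d.trace (r + s) = d.trace r + d.trace s := by
  simp only [trace, Gam_add]
  exact finsum_add_distrib (d.finite_support_Gam hfin r) (d.finite_support_Gam hfin s)

lemma trace_zero : d.trace 0 = 0 := by simp [trace, Gam_zero]

lemma trace_central_mul (hfin : {g : G | 𝒜 g ≠ ⊥}.Finite) {s : A} (hs : ∀ a, s * a = a * s)
    (r : A) : d.trace (s * r) = s * d.trace r := by
  rw [d.mul_trace hfin, trace]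
  refine finsum_congr fun g => ?_
  simp only [Gam, Finset.mul_sum]
  refine Finset.sum_congr rfl fun i _ => ?_
  rw [← mul_assoc, ← hs, mul_assoc s, mul_assoc s]

/-! ### The candidate for the separability element -/

/-- The element `∑ i, x i ⊗ y i` of `A ⊗ Aᵐᵒᵖ`. -/
noncomputable def galoisTensor (S : Type*) [CommRing S] [Algebra S A] {m : ℕ} (x y : Fin m → A) :
    A ⊗[S] Aᵐᵒᵖ :=
  ∑ i, x i ⊗ₜ[S] op (y i)

/-- The component of index `g` of the separability element of `A`. -/
noncomputable def separabilitySummand (S : Type*) [CommRing S] [Algebra S A] {m : ℕ} (c : A)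
    (x y : Fin m → A) (g : G) : A ⊗[S] Aᵐᵒᵖ :=
  ∑ j, ((d.u g j * c) ⊗ₜ[S] op (d.v g j)) * galoisTensor S x y

lemma finite_support_separabilitySummand {S : Type*} [CommRing S]
    [Algebra S A] {m : ℕ} (hfin : {g : G | 𝒜 g ≠ ⊥}.Finite) (c : A)
    (x y : Fin m → A) : (Function.support (d.separabilitySummand S c x y)).Finite :=
  d.finite_support_of_u_eq_zero hfin fun g hg => by simp [separabilitySummand, hg]

/-! ### Invariance of traces -/

section GradedMonoid

variable [SetLike.GradedMonoid fun i : Additive G => 𝒜 i.toMul]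

lemma trace_mem {r : A} (hr : r ∈ gradeOne 𝒜) : d.trace r ∈ gradeOne 𝒜 :=
  finsum_induction (· ∈ gradeOne 𝒜) (zero_mem _) (fun _ _ => add_mem) fun _ => d.Gam_mem hr

lemma Gam_mul_eps_inv (hR : ∀ r s : gradeOne 𝒜, r * s = s * r) (g : G) {r : A}
    (hr : r ∈ gradeOne 𝒜) : d.Gam g (r * h.eps g⁻¹) = d.Gam g r := by
  rw [d.Gam_mul_map hR hr (h.eps_mem _), d.Gam_eps hR, mul_inv_cancel, eps_one, mul_one,
    d.Gam_mul_eps]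

lemma Gam_one_left (hR : ∀ r s : gradeOne 𝒜, r * s = s * r) {r : A} (hr : r ∈ gradeOne 𝒜) :
    d.Gam 1 r = r := by
  simpa using d.Gam_mul hR (g := 1) hr (gradeOne 𝒜).one_mem

lemma Gam_Gam_eq (hR : ∀ r s : gradeOne 𝒜, r * s = s * r) (g k : G) {r : A}
    (hr : r ∈ gradeOne 𝒜) : d.Gam g (d.Gam k r) = d.Gam (g * k) r * h.eps g := by
  rw [← d.Gam_mul_eps_inv hR k hr, d.Gam_Gam hR (mul_mem hr (h.eps_mem _))
      (by rw [mul_assoc, h.eps_idem]), d.Gam_mul_map hR hr (h.eps_mem _), d.Gam_eps hR,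
    mul_inv_cancel_right, ← mul_assoc, d.Gam_mul_eps]

/-- Partial traces are invariant. -/
lemma Gam_trace (hfin : {g : G | 𝒜 g ≠ ⊥}.Finite) (hR : ∀ r s : gradeOne 𝒜, r * s = s * r) (k : G)
    {r : A} (hr : r ∈ gradeOne 𝒜) :
    d.Gam k (d.trace r) = d.trace r * h.eps k := by
  have hmap : d.Gam k (d.trace r) = ∑ᶠ g, d.Gam k (d.Gam g r) :=
    (AddMonoidHom.mk' (d.Gam k) (d.Gam_add k)).map_finsum (d.finite_support_Gam hfin r)
  simp only [hmap, d.Gam_Gam_eq hR k _ hr]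
  rw [trace, finsum_mul' _ _ (d.finite_support_Gam hfin r)]
  exact finsum_comp_equiv (Equiv.mulLeft k) (f := fun g => d.Gam g r * h.eps k)

/-! ### Partial Galois coordinates -/

variable [DecidableEq G] {m : ℕ} {x y : Fin m → A}

/-- The elements `x i`, `y i` of `R` form a partial Galois coordinate system for `γ`. Since
`Γ_g(r ε_{g⁻¹}) = Γ_g(r)`, the idempotents `ε_{g⁻¹}` are omitted. -/
structure IsGaloisSystem (x y : Fin m → A) : Prop where
  left_mem : ∀ i, x i ∈ gradeOne 𝒜
  right_mem : ∀ i, y i ∈ gradeOne 𝒜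
  sum_eq : ∀ g, ∑ i, x i * d.Gam g (y i) = if g = 1 then 1 else 0

variable {d}

/-- The mirror image of `IsGaloisSystem.sum_eq`, obtained by applying `Γ_g` to the equation of index
`g⁻¹`. -/
lemma IsGaloisSystem.sum_Gam_mul (H : d.IsGaloisSystem x y)
    (hR : ∀ r s : gradeOne 𝒜, r * s = s * r) (g : G) :
    ∑ i, d.Gam g (x i) * y i = if g = 1 then 1 else 0 := by
  have h1 : d.Gam g (∑ i, x i * d.Gam g⁻¹ (y i)) = ∑ i, d.Gam g (x i) * y i := by
    rw [d.Gam_sum]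
    refine Finset.sum_congr rfl fun i _ => ?_
    rw [d.Gam_mul_map hR (H.left_mem i) (d.Gam_mem (H.right_mem i)),
      d.Gam_Gam_eq hR _ _ (H.right_mem i), mul_inv_cancel, d.Gam_one_left hR (H.right_mem i),
      gradeOne_comm hR (H.right_mem i) (h.eps_mem g), ← mul_assoc, d.Gam_mul_eps]
  rw [← h1, H.sum_eq]
  by_cases hg : g = 1
  · simp [hg, d.Gam_one_left hR (gradeOne 𝒜).one_mem]
  · simp [hg, Gam_zero]

lemma IsGaloisSystem.sum_mul_eq_one (H : d.IsGaloisSystem x y)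
    (hR : ∀ r s : gradeOne 𝒜, r * s = s * r) : ∑ i, x i * y i = 1 := by
  simpa [d.Gam_one_left hR (H.right_mem _)] using H.sum_eq 1

/-- Dual basis formula for the trace. -/
lemma IsGaloisSystem.sum_mul_trace (H : d.IsGaloisSystem x y) (hfin : {g : G | 𝒜 g ≠ ⊥}.Finite)
    (hR : ∀ r s : gradeOne 𝒜, r * s = s * r) {r : A} (hr : r ∈ gradeOne 𝒜) :
    ∑ j, x j * d.trace (y j * r) = r := by
  have hs (j : Fin m) : (Function.support fun g => x j * d.Gam g (y j * r)).Finite :=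
    d.finite_support_of_u_eq_zero hfin fun g hg => by simp [Gam, hg]
  have hsum (g : G) : ∑ j, x j * d.Gam g (y j * r) = if g = 1 then r else 0 := by
    have : ∀ j, x j * d.Gam g (y j * r) = x j * d.Gam g (y j) * d.Gam g r := fun j => by
      rw [d.Gam_mul_map hR (H.right_mem j) hr, mul_assoc]
    simp only [this]
    rw [← Finset.sum_mul, H.sum_eq]
    by_cases hg : g = 1
    · simp [hg, d.Gam_one_left hR hr]
    · simp [hg]
  simp only [d.mul_trace hfin]
  rw [← finsum_sum_comm _ _ fun j _ => hs j]
  simp only [hsum]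
  rw [finsum_eq_single _ 1 fun g hg => if_neg hg, if_pos rfl]

/-- Dual basis formula for the trace, with the roles of the two families exchanged. -/
lemma IsGaloisSystem.sum_trace_mul (H : d.IsGaloisSystem x y) (hfin : {g : G | 𝒜 g ≠ ⊥}.Finite)
    (hR : ∀ r s : gradeOne 𝒜, r * s = s * r) {r : A} (hr : r ∈ gradeOne 𝒜) :
    ∑ i, d.trace (r * x i) * y i = r := by
  have hs (i : Fin m) : (Function.support fun g => d.Gam g (r * x i) * y i).Finite :=
    d.finite_support_of_u_eq_zero hfin fun g hg => by simp [Gam, hg]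
  have hsum (g : G) : ∑ i, d.Gam g (r * x i) * y i = if g = 1 then r else 0 := by
    have : ∀ i, d.Gam g (r * x i) * y i = d.Gam g r * (d.Gam g (x i) * y i) := fun i => by
      rw [d.Gam_mul_map hR hr (H.left_mem i), mul_assoc]
    simp only [this]
    rw [← Finset.mul_sum, H.sum_Gam_mul hR]
    by_cases hg : g = 1
    · simp [hg, d.Gam_one_left hR hr]
    · simp [hg]
  simp only [trace, finsum_mul' _ _ (d.finite_support_Gam hfin _)]
  rw [← finsum_sum_comm _ _ fun i _ => hs i]
  simp only [hsum]
  rw [finsum_eq_single _ 1 fun g hg => if_neg hg, if_pos rfl]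

/-! ### An element of trace one -/

variable {S : Type*} [CommRing S] [Algebra S A]

/-- Nakayama's lemma, applied to the span of the `x i` and to the ideal of traces. The base ring `S`
stands for `R^γ`; it is enough that it maps into `R` and that its image contains all traces. -/
theorem IsGaloisSystem.exists_trace_eq_one (H : d.IsGaloisSystem x y)
    (hfin : {g : G | 𝒜 g ≠ ⊥}.Finite) (hR : ∀ r s : gradeOne 𝒜, r * s = s * r)
    (hS : ∀ s : S, algebraMap S A s ∈ gradeOne 𝒜)
    (htr : ∀ r ∈ gradeOne 𝒜, ∃ s : S, algebraMap S A s = d.trace r) :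
    ∃ c ∈ gradeOne 𝒜, d.trace c = 1 := by
  let I : Ideal S :=
    { carrier := {s | ∃ r ∈ gradeOne 𝒜, d.trace r = algebraMap S A s}
      zero_mem' := ⟨0, zero_mem _, by rw [d.trace_zero, map_zero]⟩
      add_mem' := by
        rintro s t ⟨r, hr, hs⟩ ⟨r', hr', ht⟩
        exact ⟨r + r', add_mem hr hr', by rw [d.trace_add hfin, hs, ht, map_add]⟩
      smul_mem' := by
        rintro s t ⟨r, hr, ht⟩
        exact ⟨algebraMap S A s * r, mul_mem (hS s) hr, by
          rw [d.trace_central_mul hfin (Algebra.commutes s), ht, smul_eq_mul, map_mul]⟩ }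
  have hmul {r : A} (hr : r ∈ gradeOne 𝒜) (j : Fin m) :
      ∃ s ∈ I, x j * d.trace (y j * r) = s • x j := by
    have hyr := mul_mem (H.right_mem j) hr
    obtain ⟨s, hs⟩ := htr _ hyr
    exact ⟨s, ⟨_, hyr, hs.symm⟩, by rw [← hs, Algebra.smul_def, Algebra.commutes]⟩
  let N : Submodule S A := Submodule.span S (Set.range x)
  have hx (j : Fin m) : x j ∈ N := Submodule.subset_span ⟨j, rfl⟩
  have hle : N ≤ I • N := by
    refine Submodule.span_le.2 ?_
    rintro _ ⟨i, rfl⟩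
    rw [SetLike.mem_coe, ← H.sum_mul_trace hfin hR (H.left_mem i)]
    refine sum_mem fun j _ => ?_
    obtain ⟨s, hs, hj⟩ := hmul (H.left_mem i) j
    exact hj ▸ Submodule.smul_mem_smul hs (hx j)
  have hone : (1 : A) ∈ N := by
    rw [← H.sum_mul_trace hfin hR (gradeOne 𝒜).one_mem]
    refine sum_mem fun j _ => ?_
    obtain ⟨s, -, hj⟩ := hmul (gradeOne 𝒜).one_mem j
    exact hj ▸ N.smul_mem s (hx j)
  obtain ⟨s, hs, hs'⟩ := Submodule.exists_sub_one_mem_and_smul_eq_zero_of_fg_of_le_smul I N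
    (Submodule.fg_span (Set.finite_range x)) hle
  obtain ⟨c, hc, hct⟩ := I.neg_mem hs
  refine ⟨c, hc, ?_⟩
  have h0 : algebraMap S A s = 0 := by simpa [Algebra.smul_def] using hs' 1 hone
  simpa [h0] using hct

/-! ### Centrality of the separability element -/

/-- For `r ∈ R`, expand `r * x i` in the `x j` with coefficients the traces of `y j * r * x i`, move
these coefficients across the tensor sign and sum over `i`. -/
lemma IsGaloisSystem.galoisTensor_comm (H : d.IsGaloisSystem x y)
    (hfin : {g : G | 𝒜 g ≠ ⊥}.Finite) (hR : ∀ r s : gradeOne 𝒜, r * s = s * r)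
    (htr : ∀ r ∈ gradeOne 𝒜, ∃ s : S, algebraMap S A s = d.trace r)
    {r : A} (hr : r ∈ gradeOne 𝒜) :
    (r ⊗ₜ[S] (1 : Aᵐᵒᵖ)) * galoisTensor S x y = ((1 : A) ⊗ₜ[S] op r) * galoisTensor S x y := by
  choose t ht using fun i j =>
    htr (y j * r * x i) (mul_mem (mul_mem (H.right_mem j) hr) (H.left_mem i))
  have hleft (i : Fin m) : r * x i = ∑ j, t i j • x j := by
    rw [← H.sum_mul_trace hfin hR (mul_mem hr (H.left_mem i))]
    refine Finset.sum_congr rfl fun j _ => ?_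
    rw [← mul_assoc, ← ht, Algebra.smul_def, Algebra.commutes]
  have hright (j : Fin m) : ∑ i, t i j • op (y i) = op (y j * r) := by
    rw [← H.sum_trace_mul hfin hR (mul_mem (H.right_mem j) hr), Finset.op_sum]
    refine Finset.sum_congr rfl fun i _ => ?_
    rw [← ht, ← Algebra.smul_def, MulOpposite.op_smul]
  simp only [galoisTensor, Finset.mul_sum, Algebra.TensorProduct.tmul_mul_tmul, one_mul, hleft,
    ← MulOpposite.op_mul, ← hright, TensorProduct.sum_tmul, TensorProduct.tmul_sum]
  rw [Finset.sum_comm]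
  simp only [TensorProduct.smul_tmul]

lemma IsGaloisSystem.separabilitySummand_comm (H : d.IsGaloisSystem x y)
    (hfin : {g : G | 𝒜 g ≠ ⊥}.Finite) (hR : ∀ r s : gradeOne 𝒜, r * s = s * r)
    (htr : ∀ r ∈ gradeOne 𝒜, ∃ s : S, algebraMap S A s = d.trace r)
    {c : A} (hc : c ∈ gradeOne 𝒜) {k : G} {a : A} (ha : a ∈ 𝒜 k) (g : G) :
    (a ⊗ₜ[S] (1 : Aᵐᵒᵖ)) * d.separabilitySummand S c x y g =
      ((1 : A) ⊗ₜ[S] op a) * d.separabilitySummand S c x y (k * g) := by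
  have hw (i : Fin (d.n (k * g))) (j : Fin (d.n g)) :
      d.v (k * g) i * (a * d.u g j) ∈ gradeOne 𝒜 := by
    have := grade_mul_mem 𝒜 (d.v_mem (k * g) i) (grade_mul_mem 𝒜 ha (d.u_mem g j))
    rwa [inv_mul_cancel] at this
  -- `a * u` has degree `k * g`, so it is fixed by `ε_{k g} = ∑ i, u_i v_i`.
  have hau (j : Fin (d.n g)) :
      a * d.u g j * c =
        ∑ i, d.u (k * g) i * c * (d.v (k * g) i * (a * d.u g j)) := by
    conv_lhs => rw [← h.eps_mul (grade_mul_mem 𝒜 ha (d.u_mem g j)), ← d.sum_eq, Finset.sum_mul,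
      Finset.sum_mul]
    refine Finset.sum_congr rfl fun i _ => ?_
    rw [mul_assoc (d.u (k * g) i) c, gradeOne_comm hR hc (hw i j)]
    simp only [mul_assoc]
  have hva (i : Fin (d.n (k * g))) :
      ∑ j, d.v (k * g) i * (a * d.u g j) * d.v g j = d.v (k * g) i * a := by
    have hm := grade_mul_mem 𝒜 (d.v_mem (k * g) i) ha
    rw [mul_inv_rev, inv_mul_cancel_right] at hm
    have := h.mul_eps hm
    rw [inv_inv, ← d.sum_eq, Finset.mul_sum] at this
    simpa only [mul_assoc] using this
  have hterm (i : Fin (d.n (k * g))) (j : Fin (d.n g)) :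
      ((d.u (k * g) i * c * (d.v (k * g) i * (a * d.u g j))) ⊗ₜ[S] op (d.v g j)) *
        galoisTensor S x y =
      ((d.u (k * g) i * c) ⊗ₜ[S] op (d.v (k * g) i * (a * d.u g j) * d.v g j)) *
        galoisTensor S x y := by
    have h1 := H.galoisTensor_comm (S := S) hfin hR htr (hw i j)
    have h2 := congrArg (((d.u (k * g) i * c) ⊗ₜ[S] op (d.v g j)) * ·) h1
    simpa only [← mul_assoc, Algebra.TensorProduct.tmul_mul_tmul, mul_one, ← MulOpposite.op_mul]
      using h2
  simp only [separabilitySummand, Finset.mul_sum, ← mul_assoc (_ ⊗ₜ[S] _) (_ ⊗ₜ[S] _),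
    Algebra.TensorProduct.tmul_mul_tmul, one_mul, ← MulOpposite.op_mul]
  calc _ = ∑ j, ∑ i, ((d.u (k * g) i * c) ⊗ₜ[S]
        op (d.v (k * g) i * (a * d.u g j) * d.v g j)) * galoisTensor S x y := by
        refine Finset.sum_congr rfl fun j _ => ?_
        rw [← mul_assoc, hau, TensorProduct.sum_tmul, Finset.sum_mul]
        exact Finset.sum_congr rfl fun i _ => hterm i j
    _ = _ := by
        rw [Finset.sum_comm]
        refine Finset.sum_congr rfl fun i _ => ?_
        rw [← Finset.sum_mul, ← TensorProduct.tmul_sum, ← Finset.op_sum, hva]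

end GradedMonoid

/-! ### Homogeneous decomposition -/

variable [DecidableEq G] [GradedRing fun i : Additive G => 𝒜 i.toMul] {m : ℕ} {x y : Fin m → A}
  {d}

lemma homogeneous_induction {p : A → Prop} (zero : p 0) (add : ∀ a b, p a → p b → p (a + b))
    (mem : ∀ (g : G), ∀ a ∈ 𝒜 g, p a) (a : A) : p a :=
  DirectSum.Decomposition.inductionOn (fun i : Additive G => 𝒜 i.toMul) zero
    (fun {i} b => mem i.toMul b b.2) add a

theorem IsGaloisSystem.isSeparableAlgebra {S : Type*} [CommRing S] [Algebra S A]
    (H : d.IsGaloisSystem x y)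
    (hfin : {g : G | 𝒜 g ≠ ⊥}.Finite) (hR : ∀ r s : gradeOne 𝒜, r * s = s * r)
    (hS : ∀ s : S, algebraMap S A s ∈ gradeOne 𝒜)
    (htr : ∀ r ∈ gradeOne 𝒜, ∃ s : S, algebraMap S A s = d.trace r) :
    IsSeparableAlgebra S A := by
  obtain ⟨c, hc, hc1⟩ := H.exists_trace_eq_one hfin hR hS htr
  have hf := d.finite_support_separabilitySummand (S := S) hfin c x y
  refine .of_separabilityElement (∑ᶠ g, d.separabilitySummand S c x y g) (fun a => ?_) ?_
  · induction a using homogeneous_induction (𝒜 := 𝒜) with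
    | zero => simp
    | add a b ha hb =>
      rw [TensorProduct.add_tmul, add_mul, ha, hb, MulOpposite.op_add, TensorProduct.tmul_add,
        add_mul]
    | mem k a ha =>
      rw [mul_finsum' _ _ hf, mul_finsum' _ _ hf]
      simp only [H.separabilitySummand_comm hfin hR htr hc ha]
      exact finsum_comp_equiv (Equiv.mulLeft k)
        (f := fun g => ((1 : A) ⊗ₜ[S] op a) * d.separabilitySummand S c x y g)
  · let := instModuleTensorProductMop S A
    have hsmul (a b b' : A) : (a ⊗ₜ[S] op b) • b' = a * (b' * b) := rfl
    have hE : galoisTensor S x y • (1 : A) = 1 := by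
      simpa [galoisTensor, Finset.sum_smul, hsmul] using H.sum_mul_eq_one hR
    have hT (g : G) : d.separabilitySummand S c x y g • (1 : A) = d.Gam g c := by
      simp [separabilitySummand, Finset.sum_smul, mul_smul, hE, hsmul, Gam]
    rw [finsum_smul' hf]
    simpa only [hT, trace] using hc1

/-- Conjugation by a partial Galois coordinate system projects onto the degree-one component. -/
lemma IsGaloisSystem.sum_mul_mul_mem (H : d.IsGaloisSystem x y)
    (hR : ∀ r s : gradeOne 𝒜, r * s = s * r) (a : A) : ∑ i, x i * a * y i ∈ gradeOne 𝒜 := by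
  induction a using homogeneous_induction (𝒜 := 𝒜) with
  | zero => simp
  | add a b ha hb => simpa [mul_add, add_mul, Finset.sum_add_distrib] using add_mem ha hb
  | mem g a ha =>
    have : ∀ i, x i * a * y i = x i * d.Gam g (y i) * a := fun i => by
      rw [mul_assoc, mul_assoc, d.Gam_mul hR (H.right_mem i) ha]
    simp only [this]
    rw [← Finset.sum_mul, H.sum_eq]
    split_ifs with hg
    · subst hg
      simpa [mem_gradeOne] using ha
    · simp

/-- `R` is its own centralizer in `A`. -/
theorem IsGaloisSystem.mem_gradeOne_of_commute (H : d.IsGaloisSystem x y)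
    (hR : ∀ r s : gradeOne 𝒜, r * s = s * r) {a : A} (ha : ∀ r ∈ gradeOne 𝒜, a * r = r * a) :
    a ∈ gradeOne 𝒜 := by
  have := H.sum_mul_mul_mem hR a
  simpa [← ha _ (H.left_mem _), mul_assoc, ← Finset.mul_sum, H.sum_mul_eq_one hR] using this

/-- Invariance under `γ`, expressed through `Γ` without the idempotents `ε_{g⁻¹}`. -/
lemma mem_invariants {hR : ∀ r s : gradeOne 𝒜, r * s = s * r} {r : gradeOne 𝒜}
    (hr : ∀ g, d.Gam g r = r * h.eps g) : r ∈ (d.gamma hR).invariants := fun g =>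
  Subtype.ext ((d.Gam_mul_eps_inv hR g r.2).trans (hr g))

/-- A central element of `A` that lies in `R` is invariant. -/
lemma mem_invariants_of_mem_center {hR : ∀ r s : gradeOne 𝒜, r * s = s * r} {r : gradeOne 𝒜}
    (hr : (r : A) ∈ Subring.center A) : r ∈ (d.gamma hR).invariants :=
  mem_invariants fun g => by
    rw [← d.sum_eq, Finset.mul_sum, Gam]
    refine Finset.sum_congr rfl fun i _ => ?_
    rw [Subring.mem_center_iff.1 hr, mul_assoc]

end IsEpsilonStronglyGraded.Factorization

open IsEpsilonStronglyGraded.Factorization in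
theorem theorem3 {G A : Type*} [Group G] [DecidableEq G] [Ring A]
    (𝒜 : G → AddSubgroup A) [GradedRing fun i : Additive G => 𝒜 i.toMul]
    (hfin : {g : G | 𝒜 g ≠ ⊥}.Finite)
    (hε : IsEpsilonStronglyGraded 𝒜) (d : hε.Factorization)
    (hR : ∀ r s : gradeOne 𝒜, r * s = s * r)
    (hGal : (d.gamma hR).IsPartialGalois) :
    letI := d.invariantsCommRing hR
    letI := d.invariantsAlgebra hR
    IsAzumayaAlgebra (d.gamma hR).invariants A ∧
      Maximal (fun B : Subalgebra (d.gamma hR).invariants A => ∀ x ∈ B, ∀ y ∈ B, x * y = y * x)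
        (d.gradeOneSubalgebra hR) := by
  let := d.invariantsCommRing hR
  let := d.invariantsAlgebra hR
  obtain ⟨m, -, x, y, hxy⟩ := hGal
  have H : d.IsGaloisSystem (fun i => (x i : A)) (fun i => (y i : A)) :=
    { left_mem := fun i => (x i).2
      right_mem := fun i => (y i).2
      sum_eq := fun g => by
        have h1 : ∑ i, (x i : A) * d.Gam g (y i * hε.eps g⁻¹) =
            ((if g = 1 then 1 else 0 : gradeOne 𝒜) : A) := by
          have := congrArg (gradeOne 𝒜).subtype (hxy g)
          rw [map_sum] at this
          exact this.trans (by split_ifs <;> rfl)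
        simp only [d.Gam_mul_eps_inv hR g (y _).2] at h1
        rw [h1]
        split_ifs <;> rfl }
  have hmap (s : (d.gamma hR).invariants) : algebraMap (d.gamma hR).invariants A s = s := rfl
  refine ⟨⟨fun s t hst => Subtype.ext (Subtype.ext hst), ?_, ?_⟩, ?_, ?_⟩
  · ext a
    constructor
    · rintro ⟨s, rfl⟩
      exact Subring.mem_center_iff.2 fun b => (d.invariants_comm hR s b).symm
    · intro ha
      have haR : a ∈ gradeOne 𝒜 := H.mem_gradeOne_of_commute hR fun r _ =>
        (Subring.mem_center_iff.1 ha r).symm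
      exact ⟨⟨⟨a, haR⟩, mem_invariants_of_mem_center ha⟩, rfl⟩
  · refine H.isSeparableAlgebra hfin hR (fun s => s.1.2) fun r hr => ?_
    exact ⟨⟨⟨d.trace r, d.trace_mem hr⟩, mem_invariants fun g => d.Gam_trace hfin hR g hr⟩, rfl⟩
  · exact fun a ha b hb => gradeOne_comm hR ha hb
  · exact fun B hB hle a ha => H.mem_gradeOne_of_commute hR fun r hr => hB a ha r (hle hr)
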